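/- Let $f:\{0,1\}^m\to\{0,1\}$. In the certificate game of $f$ one player receives $x\in f^{-1}(0)$, the other receives $y\in f^{-1}(1)$, they output indices $a,b\in[m]$ without communicating, and they win if $a=b$ and $x_a\ne y_a$. For a strategy let $\omega(x,y)$ be its winning probability on $(x,y)$. The minimum (infimum) over strategies of $\max_{x\in f^{-1}(0),\,y\in f^{-1}(1)} 1/\omega(x,y)$ (with $1/0=\infty$) is denoted - $\mathsf{CG}(f)$ for private coin strategies: distributions $p_x$ on $[m]$, one for each input $x$, and $\omega(x,y)=\sum_{i:x_i\ne y_i}p_{x}(i)\,p_{y}(i)$; - $\mathsf{CG}^{\mathrm{pub}}(f)$ for public coin strategies: probability distributions $p$ on the pairs $(A,B)$ of deterministic strategies $A:f^{-1}(0)\to[m]$, $B:f^{-1}(1)\to[m]$, where $\omega(x,y)$ is the total weight of the pairs with $A(x)=B(y)=i$ and $x_i\neq y_i$ for some $i$; - $\mathsf{CG}^{\mathrm{ns}}(f)$ for non-signaling strategies: real, possibly negative coefficients $\lambda_{A,B}$ with $\sum_{A,B}\lambda_{A,B}=1$ and $\sum_{A,B:\,A(x)=a,\,B(y)=b}\lambda_{A,B}\ge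 0$ for all $x\in f^{-1}(0)$, $y\in f^{-1}(1)$, $a,b\in[m]$, with $\omega(x,y)$ defined in the same way from $\lambda$. Let $\mathsf{Tribes}_{s,t}=\mathsf{OR}_s\circ\mathsf{AND}_t$, that is, $\mathsf{Tribes}_{s,t}(x)=\bigvee_{i=1}^{s}\bigwedge_{j=1}^{t}x_{i,j}$. Then, for $n$ ranging over the positive perfect squares and $n\to\infty$ in the asymptotic claims: 1. $\mathsf{CG}^{\mathrm{pub}}(\mathsf{OR}_{\sqrt n})=\mathsf{CG}^{\mathrm{ns}}(\mathsf{OR}_{\sqrt n})$, and this is $\Theta(\sqrt n)$; also $\mathsf{CG}^{\mathrm{pub}}(\mathsf{AND}_{\sqrt n})$ and $\mathsf{CG}^{\mathrm{ns}}(\mathsf{AND}_{\sqrt n})$ are $\Theta(\sqrt n)$. 2. $\mathsf{CG}^{\mathrm{pub}}(\mathsf{Tribes}_{\sqrt n,\sqrt n})$ and $\mathsf{CG}^{\mathrm{ns}}(\mathsf{Tribes}_{\sqrt n,\sqrt n})$ are both $\Theta(\sqrt n)$. 3. $\mathsf{CG}(\mathsf{Tribes}_{\sqrt n,\sqrt n})=\Theta(n)$.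 4. Hence $\mathsf{CG}^{\mathrm{pub}}$ and $\mathsf{CG}^{\mathrm{ns}}$ do not compose multiplicatively: for $M=\mathsf{CG}^{\mathrm{pub}}$ and for $M=\mathsf{CG}^{\mathrm{ns}}$, $M(\mathsf{OR}_{\sqrt n}\circ\mathsf{AND}_{\sqrt n})$ is not $\Theta\big(M(\mathsf{OR}_{\sqrt n})\cdot M(\mathsf{AND}_{\sqrt n})\big)$. -/

import Mathlib

open scoped ENNReal Asymptotics

namespace CertificateGame

/-- The inputs `x` with `f x = 0`. -/
abbrev Zeros {ι : Type} (f : (ι → Bool) → Bool) : Type := {x : ι → Bool // f x = false}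

/-- The inputs `y` with `f y = 1`. -/
abbrev Ones {ι : Type} (f : (ι → Bool) → Bool) : Type := {y : ι → Bool // f y = true}

/-- A private coin strategy: for every input `x`, a probability distribution `p x` on the indices. -/
structure PrivateStrategy (ι : Type) [Fintype ι] where
  prob : (ι → Bool) → ι → ℝ
  nonneg : ∀ x i, 0 ≤ prob x i
  sum_eq_one : ∀ x, ∑ i, prob x i = 1

/-- The probability that both players output the same index `i` and that `x i ≠ y i`, when each
draws his output from his own distribution, independently of the other. -/
noncomputable def PrivateStrategy.win {ι : Type} [Fintype ι] (p : PrivateStrategy ι)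
    (x y : ι → Bool) : ℝ :=
  ∑ i with x i ≠ y i, p.prob x i * p.prob y i

/-- Pairs `(A, B)` of deterministic strategies: `A` for the player who is given an input of value
`0`, and `B` for the player who is given an input of value `1`. -/
def DetPair {ι : Type} (f : (ι → Bool) → Bool) : Type := (Zeros f → ι) × (Ones f → ι)

instance {ι : Type} [Fintype ι] [DecidableEq ι] (f : (ι → Bool) → Bool) : Fintype (DetPair f) :=
  inferInstanceAs (Fintype ((Zeros f → ι) × (Ones f → ι)))

/-- `(A, B)` is correct on `x, y` if both output the same index and `x, y` differ there. -/
def DetPair.Correct {ι : Type} {f : (ι → Bool) → Bool} (s : DetPair f)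
    (x : Zeros f) (y : Ones f) : Prop :=
  s.1 x = s.2 y ∧ x.1 (s.1 x) ≠ y.1 (s.1 x)

instance {ι : Type} [DecidableEq ι] {f : (ι → Bool) → Bool} (s : DetPair f)
    (x : Zeros f) (y : Ones f) : Decidable (DetPair.Correct s x y) :=
  inferInstanceAs (Decidable (_ ∧ _))

/-- A public coin strategy: a probability distribution on the pairs of deterministic strategies. -/
structure PublicStrategy {ι : Type} [Fintype ι] [DecidableEq ι] (f : (ι → Bool) → Bool) where
  prob : DetPair f → ℝ
  nonneg : ∀ s, 0 ≤ prob s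
  sum_eq_one : ∑ s, prob s = 1

/-- The winning probability of a public coin strategy on `x, y`. -/
noncomputable def PublicStrategy.win {ι : Type} [Fintype ι] [DecidableEq ι]
    {f : (ι → Bool) → Bool} (p : PublicStrategy f) (x : Zeros f) (y : Ones f) : ℝ :=
  ∑ s with DetPair.Correct s x y, p.prob s

/-- A non-signaling strategy, as an affine combination of pairs of deterministic strategies. The
coefficients may be negative, but the resulting probability of each pair `(a, b)` of outputs on
each pair `(x, y)` of inputs must not be. -/
structure NonSignalingStrategy {ι : Type} [Fintype ι] [DecidableEq ι]
    (f : (ι → Bool) → Bool) where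
  coeff : DetPair f → ℝ
  sum_eq_one : ∑ s, coeff s = 1
  nonneg : ∀ (x : Zeros f) (y : Ones f) (a b : ι),
    0 ≤ ∑ s : DetPair f with s.1 x = a ∧ s.2 y = b, coeff s

/-- The winning probability of a non-signaling strategy on `x, y`. -/
noncomputable def NonSignalingStrategy.win {ι : Type} [Fintype ι] [DecidableEq ι]
    {f : (ι → Bool) → Bool} (p : NonSignalingStrategy f) (x : Zeros f) (y : Ones f) : ℝ :=
  ∑ s with DetPair.Correct s x y, p.coeff s

/-- Private coin certificate game complexity (in `[0, ∞]`, with `1 / 0 = ∞`). -/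
noncomputable def CG {ι : Type} [Fintype ι] (f : (ι → Bool) → Bool) : ℝ≥0∞ :=
  ⨅ p : PrivateStrategy ι, ⨆ (x : Zeros f) (y : Ones f), 1 / ENNReal.ofReal (p.win x y)

/-- Public coin certificate game complexity. -/
noncomputable def CGpub {ι : Type} [Fintype ι] [DecidableEq ι] (f : (ι → Bool) → Bool) : ℝ≥0∞ :=
  ⨅ p : PublicStrategy f, ⨆ (x : Zeros f) (y : Ones f), 1 / ENNReal.ofReal (p.win x y)

/-- Non-signaling certificate game complexity. -/
noncomputable def CGns {ι : Type} [Fintype ι] [DecidableEq ι] (f : (ι → Bool) → Bool) : ℝ≥0∞ :=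
  ⨅ p : NonSignalingStrategy f, ⨆ (x : Zeros f) (y : Ones f), 1 / ENNReal.ofReal (p.win x y)

/-- `OR` of `m` bits. -/
def orFn (m : ℕ) (x : Fin m → Bool) : Bool := decide (∃ i, x i = true)

/-- `AND` of `m` bits. -/
def andFn (m : ℕ) (x : Fin m → Bool) : Bool := decide (∀ i, x i = true)

/-- The composition `f ∘ g` of Boolean functions: `f` applied to the values of `g` on disjoint
blocks of variables. -/
def compose {ι κ : Type} (f : (ι → Bool) → Bool) (g : (κ → Bool) → Bool) :
    (ι × κ → Bool) → Bool :=
  fun x => f fun i => g fun j => x (i, j)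

/-- `Tribes_{s,t} = OR_s ∘ AND_t`. -/
def tribes (s t : ℕ) : (Fin s × Fin t → Bool) → Bool := compose (orFn s) (andFn t)

theorem tribes_eq_true_iff (s t : ℕ) (x : Fin s × Fin t → Bool) :
    tribes s t x = true ↔ ∃ i, ∀ j, x (i, j) = true := by
  simp [tribes, compose, orFn, andFn]

end CertificateGame

/-! Write `k` for `√n`. An input with `k` sensitive indices already forces `CGns ≥ k`: under
non-signaling its holder's output distribution does not depend on the neighbour given to the other
player, and winning on each of the `k` neighbours costs mass at a different index. As `CGns ≤
CGpub`, public strategies of value `O(k)` finish items 1 and 2.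

For OR and AND the players share a uniform index. For Tribes they share a random position in every
block. They win if these positions hit the chosen zeros of `x` only in a block of ones of `y`, which
has probability `(1/k)(1 - 1/k)^(k-1) ≥ 1/(e k)` (`CGpub_tribes_le`).

Private coins cannot correlate the block with the position. Over pairs of inputs differing in one
index, each player's probability of that index averages at most `1/k`, so by AM-GM some product is
at most `1/k^2` (`le_CG_tribes`). -/

namespace CertificateGame

/-! ### General bounds: uniform shared seeds, sensitivity -/

section Bounds

theorem one_div_ofReal_le {K w : ℝ} (hK : 0 < K) (h : K⁻¹ ≤ w) :
    1 / ENNReal.ofReal w ≤ ENNReal.ofReal K := by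
  rw [one_div, ENNReal.inv_le_iff_inv_le, ← ENNReal.ofReal_inv_of_pos hK]
  exact ENNReal.ofReal_le_ofReal h

theorem le_one_div_ofReal {K w : ℝ} (hK : 0 < K) (h : w ≤ K⁻¹) :
    ENNReal.ofReal K ≤ 1 / ENNReal.ofReal w := by
  rw [one_div, ENNReal.le_inv_iff_le_inv, ← ENNReal.ofReal_inv_of_pos hK]
  exact ENNReal.ofReal_le_ofReal h

variable {ι : Type} [Fintype ι] {f : (ι → Bool) → Bool}

theorem CG_le {K : ℝ} (hK : 0 < K) (p : PrivateStrategy ι)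
    (h : ∀ (x : Zeros f) (y : Ones f), K⁻¹ ≤ p.win x y) : CG f ≤ ENNReal.ofReal K :=
  iInf_le_of_le p <| iSup_le fun x => iSup_le fun y => one_div_ofReal_le hK (h x y)

theorem le_CG {K : ℝ} (hK : 0 < K)
    (h : ∀ p : PrivateStrategy ι, ∃ (x : Zeros f) (y : Ones f), p.win x y ≤ K⁻¹) :
    ENNReal.ofReal K ≤ CG f :=
  le_iInf fun p => by
    obtain ⟨x, y, hxy⟩ := h p
    exact le_iSup_of_le x <| le_iSup_of_le y <| le_one_div_ofReal hK hxy

variable [DecidableEq ι]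

theorem CGpub_le {K : ℝ} (hK : 0 < K) (p : PublicStrategy f)
    (h : ∀ (x : Zeros f) (y : Ones f), K⁻¹ ≤ p.win x y) : CGpub f ≤ ENNReal.ofReal K :=
  iInf_le_of_le p <| iSup_le fun x => iSup_le fun y => one_div_ofReal_le hK (h x y)

theorem le_CGns {K : ℝ} (hK : 0 < K)
    (h : ∀ p : NonSignalingStrategy f, ∃ (x : Zeros f) (y : Ones f), p.win x y ≤ K⁻¹) :
    ENNReal.ofReal K ≤ CGns f :=
  le_iInf fun p => by
    obtain ⟨x, y, hxy⟩ := h p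
    exact le_iSup_of_le x <| le_iSup_of_le y <| le_one_div_ofReal hK hxy

/-- A public coin strategy is non-signaling. -/
def PublicStrategy.toNonSignaling (p : PublicStrategy f) : NonSignalingStrategy f where
  coeff := p.prob
  sum_eq_one := p.sum_eq_one
  nonneg _ _ _ _ := Finset.sum_nonneg fun s _ => p.nonneg s

theorem CGns_le_CGpub : CGns f ≤ CGpub f :=
  le_iInf fun p => iInf_le_of_le p.toNonSignaling le_rfl

/-- The pair of two given deterministic strategies. -/
def DetPair.mk (A : Zeros f → ι) (B : Ones f → ι) : DetPair f := (A, B)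

open Classical in
/-- The public coin strategy that draws a seed uniformly from a finite type. -/
noncomputable def PublicStrategy.uniform {R : Type} [Fintype R] [Nonempty R]
    (A : R → Zeros f → ι) (B : R → Ones f → ι) : PublicStrategy f where
  prob s := (Finset.card {r | DetPair.mk (A r) (B r) = s} : ℝ) / Fintype.card R
  nonneg s := by positivity
  sum_eq_one := by
    rw [← Finset.sum_div, div_eq_one_iff_eq (by simp), ← Nat.cast_sum,
      ← Finset.card_eq_sum_card_fiberwise
        (fun r _ => Finset.mem_univ (DetPair.mk (A r) (B r))), Finset.card_univ]

theorem PublicStrategy.uniform_win {R : Type} [Fintype R] [Nonempty R]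
    (A : R → Zeros f → ι) (B : R → Ones f → ι) (x : Zeros f) (y : Ones f) :
    (PublicStrategy.uniform A B).win x y =
      (Finset.card {r | A r x = B r y ∧ x.1 (A r x) ≠ y.1 (A r x)} : ℝ) / Fintype.card R := by
  classical
  unfold PublicStrategy.win PublicStrategy.uniform
  rw [← Finset.sum_div, ← Nat.cast_sum,
    Finset.card_eq_sum_card_fiberwise (f := fun r => DetPair.mk (A r) (B r))
      (s := {r | A r x = B r y ∧ x.1 (A r x) ≠ y.1 (A r x)})
      (t := {s | s.Correct x y}) (fun r hr => Finset.mem_coe.2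
        (Finset.mem_filter.2 ⟨Finset.mem_univ _, (Finset.mem_filter.1 hr).2⟩))]
  congr 2
  refine Finset.sum_congr rfl fun s hs => ?_
  rw [Finset.filter_filter]
  congr 1
  ext r
  simp only [Finset.mem_filter, Finset.mem_univ, true_and] at hs ⊢
  constructor
  · rintro rfl
    exact ⟨hs, rfl⟩
  · exact fun h => h.2

/-- Guessing a common uniformly random index wins with probability at least `1 / m`. -/
theorem CGpub_le_card [Nonempty ι] : CGpub f ≤ ENNReal.ofReal (Fintype.card ι) := by
  classical
  have hpos : (0 : ℝ) < Fintype.card ι := by exact_mod_cast Fintype.card_pos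
  refine CGpub_le hpos (PublicStrategy.uniform (fun r _ => r) fun r _ => r) ?_
  intro x y
  rw [PublicStrategy.uniform_win, inv_eq_one_div]
  have hne : ∃ i, x.1 i ≠ y.1 i := by
    by_contra! h
    have := congrArg f (funext h)
    simp [x.2, y.2] at this
  obtain ⟨i, hi⟩ := hne
  gcongr
  exact Nat.one_le_cast.2 <| Finset.card_pos.2
    ⟨i, Finset.mem_filter.2 ⟨Finset.mem_univ _, rfl, hi⟩⟩

namespace NonSignalingStrategy

variable (p : NonSignalingStrategy f)

/-- The probability of a pair of outputs. -/
noncomputable def joint (x : Zeros f) (y : Ones f) (a b : ι) : ℝ :=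
  ∑ s : DetPair f with s.1 x = a ∧ s.2 y = b, p.coeff s

/-- The probability of an output of the player who is given an input of value `0`. -/
noncomputable def marginalZero (x : Zeros f) (a : ι) : ℝ :=
  ∑ s : DetPair f with s.1 x = a, p.coeff s

/-- The probability of an output of the player who is given an input of value `1`. -/
noncomputable def marginalOne (y : Ones f) (b : ι) : ℝ :=
  ∑ s : DetPair f with s.2 y = b, p.coeff s

theorem sum_joint_left (x : Zeros f) (y : Ones f) (b : ι) :
    ∑ a, p.joint x y a b = p.marginalOne y b := by
  simp only [joint, marginalOne, Finset.sum_filter]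
  rw [Finset.sum_comm]
  refine Finset.sum_congr rfl fun s _ => ?_
  simp [ite_and]

theorem sum_joint_right (x : Zeros f) (y : Ones f) (a : ι) :
    ∑ b, p.joint x y a b = p.marginalZero x a := by
  simp only [joint, marginalZero, Finset.sum_filter]
  rw [Finset.sum_comm]
  refine Finset.sum_congr rfl fun s _ => ?_
  simp [ite_and]

theorem win_eq_joint {x : Zeros f} {y : Ones f} {c : ι}
    (h : ∀ i, x.1 i ≠ y.1 i ↔ i = c) : p.win x y = p.joint x y c c := by
  unfold win joint
  refine Finset.sum_congr ?_ fun _ _ => rfl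
  ext s
  simp only [Finset.mem_filter, Finset.mem_univ, true_and, DetPair.Correct, h]
  constructor
  · rintro ⟨h₁, h₂⟩
    exact ⟨h₂, h₁ ▸ h₂⟩
  · rintro ⟨h₁, h₂⟩
    exact ⟨h₁.trans h₂.symm, h₁⟩

end NonSignalingStrategy

theorem exists_le_inv_of_sum_le_one {k : ℕ} (hk : 1 ≤ k) {w : Fin k → ℝ}
    (h : ∑ j, w j ≤ 1) : ∃ j, w j ≤ (k : ℝ)⁻¹ := by
  by_contra! hlt
  have hk0 : (k : ℝ) ≠ 0 := by positivity
  have hne : (Finset.univ : Finset (Fin k)).Nonempty := ⟨⟨0, hk⟩, Finset.mem_univ _⟩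
  have := Finset.sum_lt_sum_of_nonempty hne fun j _ => hlt j
  simp [hk0] at this
  linarith

/-- If the `1`-input `y` has `k` sensitive indices then `k ≤ CGns f`. -/
theorem le_CGns_of_sensitive_one {k : ℕ} (hk : 1 ≤ k) (y : Ones f) (x : Fin k → Zeros f)
    (c : Fin k → ι) (hc : Function.Injective c) (h : ∀ j i, (x j).1 i ≠ y.1 i ↔ i = c j) :
    ENNReal.ofReal k ≤ CGns f := by
  refine le_CGns (by positivity) fun p => ?_
  have hnonneg : ∀ b, 0 ≤ p.marginalOne y b := fun b => by
    rw [← p.sum_joint_left (x ⟨0, hk⟩)]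
    exact Finset.sum_nonneg fun a _ => p.nonneg _ _ _ _
  -- Winning on `x j` forces the output `c j` on `y`, and the marginal on `y` is the same for all
  -- `j`.
  have hle : ∀ j, p.win (x j) y ≤ p.marginalOne y (c j) := fun j => by
    rw [p.win_eq_joint (h j), ← p.sum_joint_left (x j)]
    exact Finset.single_le_sum (f := fun a => p.joint (x j) y a (c j))
      (fun a _ => p.nonneg _ _ _ _) (Finset.mem_univ _)
  have hsum : ∑ b, p.marginalOne y b = 1 := by
    rw [← p.sum_eq_one]
    exact Finset.sum_fiberwise _ _ _
  obtain ⟨j, hj⟩ := exists_le_inv_of_sum_le_one hk (w := fun j => p.win (x j) y) <| by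
    calc ∑ j, p.win (x j) y ≤ ∑ j, p.marginalOne y (c j) := Finset.sum_le_sum fun j _ => hle j
      _ = ∑ b ∈ Finset.univ.map ⟨c, hc⟩, p.marginalOne y b := by simp
      _ ≤ ∑ b, p.marginalOne y b := Finset.sum_le_sum_of_subset_of_nonneg (Finset.subset_univ _)
          fun b _ _ => hnonneg b
      _ = 1 := hsum
  exact ⟨x j, y, hj⟩

/-- If the `0`-input `x` has `k` sensitive indices then `k ≤ CGns f`. -/
theorem le_CGns_of_sensitive_zero {k : ℕ} (hk : 1 ≤ k) (x : Zeros f) (y : Fin k → Ones f)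
    (c : Fin k → ι) (hc : Function.Injective c) (h : ∀ j i, x.1 i ≠ (y j).1 i ↔ i = c j) :
    ENNReal.ofReal k ≤ CGns f := by
  refine le_CGns (by positivity) fun p => ?_
  have hnonneg : ∀ a, 0 ≤ p.marginalZero x a := fun a => by
    rw [← p.sum_joint_right x (y ⟨0, hk⟩)]
    exact Finset.sum_nonneg fun b _ => p.nonneg _ _ _ _
  have hle : ∀ j, p.win x (y j) ≤ p.marginalZero x (c j) := fun j => by
    rw [p.win_eq_joint (h j), ← p.sum_joint_right x (y j)]
    exact Finset.single_le_sum (f := fun b => p.joint x (y j) (c j) b)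
      (fun b _ => p.nonneg _ _ _ _) (Finset.mem_univ _)
  have hsum : ∑ a, p.marginalZero x a = 1 := by
    rw [← p.sum_eq_one]
    exact Finset.sum_fiberwise _ _ _
  obtain ⟨j, hj⟩ := exists_le_inv_of_sum_le_one hk (w := fun j => p.win x (y j)) <| by
    calc ∑ j, p.win x (y j) ≤ ∑ j, p.marginalZero x (c j) := Finset.sum_le_sum fun j _ => hle j
      _ = ∑ a ∈ Finset.univ.map ⟨c, hc⟩, p.marginalZero x a := by simp
      _ ≤ ∑ a, p.marginalZero x a := Finset.sum_le_sum_of_subset_of_nonneg (Finset.subset_univ _)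
          fun a _ _ => hnonneg a
      _ = 1 := hsum
  exact ⟨x, y j, hj⟩

end Bounds

/-! ### OR and AND -/

section OrAnd

variable {k : ℕ}

theorem le_CGns_orFn (hk : 1 ≤ k) : ENNReal.ofReal k ≤ CGns (orFn k) :=
  le_CGns_of_sensitive_zero hk ⟨fun _ => false, by simp [orFn]⟩
    (fun j => ⟨fun i => decide (i = j), by simp [orFn]⟩) id Function.injective_id
    (fun j i => by simp)

theorem le_CGns_andFn (hk : 1 ≤ k) : ENNReal.ofReal k ≤ CGns (andFn k) :=
  le_CGns_of_sensitive_one hk ⟨fun _ => true, by simp [andFn]⟩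
    (fun j => ⟨fun i => !decide (i = j), by simp [andFn]⟩) id Function.injective_id
    (fun j i => by simp)

theorem CGpub_le_of_fin (f : (Fin k → Bool) → Bool) (hk : 1 ≤ k) :
    CGpub f ≤ ENNReal.ofReal k := by
  have : Nonempty (Fin k) := ⟨⟨0, hk⟩⟩
  simpa using CGpub_le_card (f := f)

theorem CGpub_orFn (hk : 1 ≤ k) : CGpub (orFn k) = ENNReal.ofReal k :=
  le_antisymm (CGpub_le_of_fin _ hk) ((le_CGns_orFn hk).trans CGns_le_CGpub)

theorem CGns_orFn (hk : 1 ≤ k) : CGns (orFn k) = ENNReal.ofReal k :=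
  le_antisymm (CGns_le_CGpub.trans (CGpub_le_of_fin _ hk)) (le_CGns_orFn hk)

theorem CGpub_andFn (hk : 1 ≤ k) : CGpub (andFn k) = ENNReal.ofReal k :=
  le_antisymm (CGpub_le_of_fin _ hk) ((le_CGns_andFn hk).trans CGns_le_CGpub)

theorem CGns_andFn (hk : 1 ≤ k) : CGns (andFn k) = ENNReal.ofReal k :=
  le_antisymm (CGns_le_CGpub.trans (CGpub_le_of_fin _ hk)) (le_CGns_andFn hk)

end OrAnd

/-! ### Tribes: public, non-signaling and private values -/

section Tribes

variable {k : ℕ}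

theorem tribes_eq_false_iff (s t : ℕ) (x : Fin s × Fin t → Bool) :
    tribes s t x = false ↔ ∀ i, ∃ j, x (i, j) = false := by
  rw [← Bool.not_eq_true, tribes_eq_true_iff]
  simp

/-- With one block of ones and zeros elsewhere, flipping any of the `k` bits of that block changes
the value. -/
theorem le_CGns_tribes (hk : 1 ≤ k) : ENNReal.ofReal k ≤ CGns (tribes k k) := by
  let i₀ : Fin k := ⟨0, hk⟩
  refine le_CGns_of_sensitive_one hk
    ⟨fun q => decide (q.1 = i₀), (tribes_eq_true_iff k k _).2 ⟨i₀, by simp⟩⟩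
    (fun j => ⟨fun q => decide (q.1 = i₀ ∧ q.2 ≠ j),
      (tribes_eq_false_iff k k _).2 fun i => ⟨j, by simp⟩⟩)
    (fun j => (i₀, j)) (fun a b h => (Prod.ext_iff.1 h).2) ?_
  rintro j ⟨a, b⟩
  by_cases ha : a = i₀ <;> by_cases hb : b = j <;> simp [ha, hb]

/-- This is `(1 + 1/m)^m ≤ e` without denominators, so that `m = 0` is covered by `0^0 = 1`. -/
theorem succ_pow_le_exp_mul_pow (m : ℕ) :
    ((m + 1 : ℕ) : ℝ) ^ m ≤ Real.exp 1 * (m : ℝ) ^ m := by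
  rcases Nat.eq_zero_or_pos m with rfl | hm
  · simp
  have hm0 : (0 : ℝ) < m := by exact_mod_cast hm
  have h1 : ((m + 1 : ℕ) : ℝ) = (1 / m + 1) * m := by
    push_cast
    field_simp
    ring
  rw [h1, mul_pow]
  gcongr
  calc (1 / (m : ℝ) + 1) ^ m ≤ Real.exp (1 / m) ^ m := by
        gcongr
        exact Real.add_one_le_exp _
    _ = Real.exp 1 := by
        rw [← Real.exp_nat_mul]
        congr 1
        field_simp

/-- The value at `b` is forced, and each of the other `m` blocks leaves `m` choices. These seeds win
for Tribes. -/
theorem card_agree_only_at {m : ℕ} (z : Fin (m + 1) → Fin (m + 1)) (b : Fin (m + 1)) :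
    Finset.card {r : Fin (m + 1) → Fin (m + 1) | ∀ i, r i = z i ↔ i = b} = m ^ m := by
  have h : ({r : Fin (m + 1) → Fin (m + 1) | ∀ i, r i = z i ↔ i = b} : Finset _) =
      Fintype.piFinset fun i => if i = b then {z i} else {z i}ᶜ := by
    ext r
    simp only [Finset.mem_filter, Finset.mem_univ, true_and, Fintype.mem_piFinset]
    refine forall_congr' fun i => ?_
    by_cases hi : i = b <;> simp [hi]
  rw [h, Fintype.card_piFinset, ← Finset.mul_prod_erase _ _ (Finset.mem_univ b)]
  rw [Finset.prod_congr rfl (g := fun _ => m) fun i hi => by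
    simp [Finset.ne_of_mem_erase hi, Finset.card_compl]]
  simp

/-- The shared randomness is a function `r` from blocks to positions in a block. The second player
outputs `(i, r i)` for a block `i` of ones, and the first player some `(i, r i)` at which his input
has its chosen zero of block `i`. -/
theorem CGpub_tribes_le (hk : 1 ≤ k) : CGpub (tribes k k) ≤ ENNReal.ofReal (Real.exp 1 * k) := by
  classical
  obtain ⟨m, rfl⟩ : ∃ m, k = m + 1 := ⟨k - 1, by omega⟩
  have hz : ∀ x : Zeros (tribes (m + 1) (m + 1)), ∃ z : Fin (m + 1) → Fin (m + 1),
      ∀ i, x.1 (i, z i) = false :=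
    fun x => Classical.skolem.1 ((tribes_eq_false_iff _ _ _).1 x.2)
  have hb : ∀ y : Ones (tribes (m + 1) (m + 1)), ∃ b, ∀ j, y.1 (b, j) = true :=
    fun y => (tribes_eq_true_iff _ _ _).1 y.2
  choose z hz using hz
  choose b hb using hb
  -- Any block of agreement will do: on the seeds counted below it is unique, and the default `0` is
  -- not reached.
  let sel (r z : Fin (m + 1) → Fin (m + 1)) : Fin (m + 1) :=
    if h : ∃ i, r i = z i then h.choose else 0
  refine CGpub_le (by positivity)
    (PublicStrategy.uniform (R := Fin (m + 1) → Fin (m + 1))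
    (fun r x => (sel r (z x), r (sel r (z x)))) fun r y => (b y, r (b y))) fun x y => ?_
  rw [PublicStrategy.uniform_win]
  have hcard : m ^ m ≤ Finset.card {r : Fin (m + 1) → Fin (m + 1) |
      (sel r (z x), r (sel r (z x))) = (b y, r (b y)) ∧
        x.1 (sel r (z x), r (sel r (z x))) ≠ y.1 (sel r (z x), r (sel r (z x)))} := by
    rw [← card_agree_only_at (z x) (b y)]
    refine Finset.card_le_card fun r hr => ?_
    simp only [Finset.mem_filter, Finset.mem_univ, true_and] at hr ⊢
    have hsel : sel r (z x) = b y := by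
      have h : ∃ i, r i = z x i := ⟨b y, (hr _).2 rfl⟩
      simp only [sel, dif_pos h]
      exact (hr _).1 h.choose_spec
    refine ⟨by simp only [hsel], ?_⟩
    simp only [hsel, hb]
    rw [(hr _).2 rfl, hz]
    simp
  refine le_trans ?_ (div_le_div_of_nonneg_right (Nat.cast_le.2 hcard) (by positivity))
  rw [Nat.cast_pow]
  have hmm : (0 : ℝ) < (m : ℝ) ^ m := by
    rcases Nat.eq_zero_or_pos m with rfl | hm
    · simp
    · positivity
  rw [inv_eq_one_div, div_le_div_iff₀ (by positivity) (by positivity)]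
  simp only [Fintype.card_pi, Fintype.card_fin, Finset.prod_const, Finset.card_univ, Nat.cast_pow]
  rw [pow_succ]
  have := mul_le_mul_of_nonneg_right (succ_pow_le_exp_mul_pow m)
    (by positivity : (0 : ℝ) ≤ ((m + 1 : ℕ) : ℝ))
  linarith

/-- A player whose input has value `0` draws a uniform block and outputs its chosen zero, and one
whose input has value `1` draws a uniform index in a block of ones. -/
theorem CG_tribes_le (hk : 1 ≤ k) : CG (tribes k k) ≤ ENNReal.ofReal ((k : ℝ) ^ 2) := by
  classical
  have : Nonempty (Fin k) := ⟨⟨0, hk⟩⟩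
  have hk0 : (k : ℝ) ≠ 0 := by positivity
  -- A private strategy is defined on all inputs, so `z` and `b` get dummy values where they are
  -- meaningless.
  have hz : ∀ x : Fin k × Fin k → Bool, ∃ z : Fin k → Fin k,
      tribes k k x = false → ∀ i, x (i, z i) = false := fun x => by
    by_cases h : tribes k k x = false
    · obtain ⟨z, hz⟩ := Classical.skolem.1 ((tribes_eq_false_iff _ _ _).1 h)
      exact ⟨z, fun _ => hz⟩
    · exact ⟨id, fun h' => absurd h' h⟩
  have hb : ∀ y : Fin k × Fin k → Bool, ∃ b, tribes k k y = true → ∀ j, y (b, j) = true :=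
    fun y => by
      by_cases h : tribes k k y = true
      · obtain ⟨b, hb⟩ := (tribes_eq_true_iff _ _ _).1 h
        exact ⟨b, fun _ => hb⟩
      · exact ⟨Classical.arbitrary _, fun h' => absurd h' h⟩
  choose z hz using hz
  choose b hb using hb
  let p : PrivateStrategy (Fin k × Fin k) :=
    { prob := fun x q => if tribes k k x = true then (if q.1 = b x then (k : ℝ)⁻¹ else 0)
        else (if q.2 = z x q.1 then (k : ℝ)⁻¹ else 0)
      nonneg := fun x q => by split_ifs <;> positivity
      sum_eq_one := fun x => by
        by_cases h : tribes k k x = true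
        · simp only [h, if_true, Fintype.sum_prod_type_right]
          simp [hk0]
        · simp only [h, Fintype.sum_prod_type]
          simp [hk0] }
  refine CG_le (by positivity) p fun x y => ?_
  -- The chosen zero of `x` in the block of ones of `y` alone gives `1/k · 1/k`.
  have hterm : ((k : ℝ) ^ 2)⁻¹ =
      p.prob x (b y, z x (b y)) * p.prob y (b y, z x (b y)) := by
    simp only [p, x.2, y.2]
    simp [sq]
  rw [hterm]
  refine Finset.single_le_sum (f := fun q => p.prob x q * p.prob y q)
    (fun q _ => mul_nonneg (p.nonneg _ _) (p.nonneg _ _)) ?_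
  simp only [Finset.mem_filter, Finset.mem_univ, true_and]
  rw [hz _ x.2, hb _ y.2]
  simp

/-- The input with the single zero `(i, z i)` in each block `i`. -/
def oneZeroPerBlock (z : Fin k → Fin k) (q : Fin k × Fin k) : Bool := !decide (q.2 = z q.1)

/-- The input with the single zero `(i', u i')` in each block `i'` other than `i`. -/
def oneZeroPerBlockExcept (i : Fin k) (u : {i' // i' ≠ i} → Fin k) (q : Fin k × Fin k) : Bool :=
  if h : q.1 = i then true else !decide (q.2 = u ⟨q.1, h⟩)

theorem oneZeroPerBlock_ne_iff (z : Fin k → Fin k) (i : Fin k) (q : Fin k × Fin k) :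
    oneZeroPerBlock z q ≠ oneZeroPerBlockExcept i (fun i' => z i') q ↔ q = (i, z i) := by
  obtain ⟨a, b⟩ := q
  by_cases ha : a = i
  · subst ha
    simp [oneZeroPerBlock, oneZeroPerBlockExcept]
  · simp [oneZeroPerBlock, oneZeroPerBlockExcept, ha]

/-- The input ignores `z i`. For fixed values of `z` off `i`, the sum over `z i` is the mass of
block `i` under one distribution, hence at most 1; there are `k^(k-1)` such restrictions. -/
theorem sum_prob_except_le (p : PrivateStrategy (Fin k × Fin k)) (i : Fin k) :
    ∑ z : Fin k → Fin k, p.prob (oneZeroPerBlockExcept i fun i' => z i') (i, z i) ≤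
      (k : ℝ) ^ (k - 1) := by
  rw [← (Equiv.funSplitAt i (Fin k)).symm.sum_comp, Fintype.sum_prod_type_right]
  calc _ ≤ ∑ u : {i' // i' ≠ i} → Fin k, (1 : ℝ) := Finset.sum_le_sum fun u _ => ?_
    _ = (k : ℝ) ^ (k - 1) := by simp
  rw [← p.sum_eq_one (oneZeroPerBlockExcept i u), Fintype.sum_prod_type]
  refine le_trans (le_of_eq ?_) (Finset.single_le_sum
    (f := fun i' => ∑ t, p.prob (oneZeroPerBlockExcept i u) (i', t))
    (fun i' _ => Finset.sum_nonneg fun t _ => p.nonneg _ _) (Finset.mem_univ i))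
  refine Finset.sum_congr rfl fun t _ => ?_
  congr 2
  · ext i'
    simp [Equiv.funSplitAt, Equiv.piSplitAt, i'.2]
  · simp [Equiv.funSplitAt, Equiv.piSplitAt]

theorem sum_prob_le (p : PrivateStrategy (Fin k × Fin k)) (x : Fin k × Fin k → Bool)
    (z : Fin k → Fin k) : ∑ i, p.prob x (i, z i) ≤ 1 := by
  rw [← p.sum_eq_one x, Fintype.sum_prod_type]
  exact Finset.sum_le_sum fun i _ => Finset.single_le_sum (f := fun j => p.prob x (i, j))
    (fun j _ => p.nonneg _ _) (Finset.mem_univ _)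

/-- Average the arithmetic-geometric mean inequality over the pairs of inputs that differ in the
single index `(i, z i)`. -/
theorem le_CG_tribes (hk : 1 ≤ k) : ENNReal.ofReal ((k : ℝ) ^ 2) ≤ CG (tribes k k) := by
  have hk0 : (0 : ℝ) < k := by exact_mod_cast hk
  refine le_CG (by positivity) fun p => ?_
  by_contra! hlt
  have hwin : ∀ (z : Fin k → Fin k) (i : Fin k), ((k : ℝ) ^ 2)⁻¹ <
      p.prob (oneZeroPerBlock z) (i, z i) *
        p.prob (oneZeroPerBlockExcept i fun i' => z i') (i, z i) := fun z i => by
    have := hlt ⟨oneZeroPerBlock z, (tribes_eq_false_iff _ _ _).2 fun i =>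
        ⟨z i, by simp [oneZeroPerBlock]⟩⟩
      ⟨oneZeroPerBlockExcept i fun i' => z i', (tribes_eq_true_iff _ _ _).2
        ⟨i, by simp [oneZeroPerBlockExcept]⟩⟩
    simpa [PrivateStrategy.win, oneZeroPerBlock_ne_iff, Finset.filter_eq'] using this
  -- AM-GM: `(a + b)^2 ≥ 4ab > (2/k)^2`.
  have hadd : ∀ (z : Fin k → Fin k) (i : Fin k), 2 * (k : ℝ)⁻¹ <
      p.prob (oneZeroPerBlock z) (i, z i) +
        p.prob (oneZeroPerBlockExcept i fun i' => z i') (i, z i) := fun z i => by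
    have h1 := hwin z i
    have h2 := p.nonneg (oneZeroPerBlock z) (i, z i)
    have h3 := p.nonneg (oneZeroPerBlockExcept i fun i' => z i') (i, z i)
    generalize p.prob (oneZeroPerBlock z) (i, z i) = a at *
    generalize p.prob (oneZeroPerBlockExcept i fun i' => z i') (i, z i) = b at *
    rw [← inv_pow] at h1
    refine lt_of_pow_lt_pow_left₀ 2 (by positivity) ?_
    nlinarith [sq_nonneg (a - b)]
  have hsum : ∑ z : Fin k → Fin k, ∑ _i : Fin k, 2 * (k : ℝ)⁻¹ <
      ∑ z : Fin k → Fin k, ∑ i, (p.prob (oneZeroPerBlock z) (i, z i) +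
        p.prob (oneZeroPerBlockExcept i fun i' => z i') (i, z i)) := by
    have hne : (Finset.univ : Finset (Fin k)).Nonempty := ⟨⟨0, hk⟩, Finset.mem_univ _⟩
    exact Finset.sum_lt_sum_of_nonempty ⟨id, Finset.mem_univ _⟩ fun z _ =>
      Finset.sum_lt_sum_of_nonempty hne fun i _ => hadd z i
  have hX : ∑ z : Fin k → Fin k, ∑ i, p.prob (oneZeroPerBlock z) (i, z i) ≤ (k : ℝ) ^ k := by
    refine (Finset.sum_le_sum fun z _ => sum_prob_le p (oneZeroPerBlock z) z).trans ?_
    simp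
  have hY : ∑ z : Fin k → Fin k, ∑ i,
      p.prob (oneZeroPerBlockExcept i fun i' => z i') (i, z i) ≤ (k : ℝ) ^ k := by
    rw [Finset.sum_comm]
    refine (Finset.sum_le_sum fun i _ => sum_prob_except_le p i).trans ?_
    simp only [Finset.sum_const, Finset.card_univ, Fintype.card_fin, nsmul_eq_mul]
    rw [mul_pow_sub_one (by omega)]
  -- The right side is at most `2 k^k` by `hX` and `hY`, but the left side equals `2 k^k`.
  simp only [Finset.sum_add_distrib] at hsum
  have hlhs : ∑ z : Fin k → Fin k, ∑ _i : Fin k, 2 * (k : ℝ)⁻¹ = 2 * (k : ℝ) ^ k := by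
    simp
    field_simp
  linarith

theorem CG_tribes (hk : 1 ≤ k) : CG (tribes k k) = ENNReal.ofReal ((k : ℝ) ^ 2) :=
  le_antisymm (CG_tribes_le hk) (le_CG_tribes hk)

end Tribes

/-! ### Asymptotic forms -/

section Asymptotics

open Filter

theorem isTheta_of_eq_ofReal {M : ℕ → ℝ≥0∞} {g : ℕ → ℝ} (hg : ∀ k, 0 ≤ g k)
    (h : ∀ k, 1 ≤ k → M k = ENNReal.ofReal (g k)) :
    (fun k => (M k).toReal) =Θ[atTop] g := by
  refine EventuallyEq.isTheta ?_
  filter_upwards [eventually_ge_atTop 1] with k hk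
  rw [h k hk, ENNReal.toReal_ofReal (hg k)]

/-- The upper bound also makes `M k` finite, so `toReal` does not turn `∞` into `0`. -/
theorem isTheta_of_le_of_le {M : ℕ → ℝ≥0∞} {C : ℝ} (hC : 0 ≤ C)
    (h₁ : ∀ k : ℕ, 1 ≤ k → ENNReal.ofReal k ≤ M k)
    (h₂ : ∀ k : ℕ, 1 ≤ k → M k ≤ ENNReal.ofReal (C * k)) :
    (fun k => (M k).toReal) =Θ[atTop] fun k : ℕ => (k : ℝ) := by
  constructor
  · refine Asymptotics.IsBigO.of_bound C ?_
    filter_upwards [eventually_ge_atTop 1] with k hk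
    rw [Real.norm_of_nonneg ENNReal.toReal_nonneg, Real.norm_of_nonneg (Nat.cast_nonneg k)]
    exact ENNReal.toReal_le_of_le_ofReal (by positivity) (h₂ k hk)
  · refine Asymptotics.IsBigO.of_bound 1 ?_
    filter_upwards [eventually_ge_atTop 1] with k hk
    rw [Real.norm_of_nonneg ENNReal.toReal_nonneg, Real.norm_of_nonneg (Nat.cast_nonneg k),
      one_mul]
    exact (ENNReal.ofReal_le_iff_le_toReal (ne_top_of_le_ne_top ENNReal.ofReal_ne_top (h₂ k hk))).1
      (h₁ k hk)

/-- Otherwise `k^2 ≤ C k` for all large `k`, which fails once `k > C`. -/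
theorem not_isTheta_mul {u v w : ℕ → ℝ} (hu : u =Θ[atTop] fun k : ℕ => (k : ℝ))
    (hv : v =Θ[atTop] fun k : ℕ => (k : ℝ)) (hw : w =Θ[atTop] fun k : ℕ => (k : ℝ)) :
    ¬ u =Θ[atTop] fun k => v k * w k := by
  intro h
  have h1 : (fun k : ℕ => (k : ℝ)) =Θ[atTop] fun k : ℕ => (k : ℝ) * (k : ℝ) :=
    hu.symm.trans (h.trans (hv.mul hw))
  obtain ⟨C, hC⟩ := h1.2.bound
  obtain ⟨k, hk, hk1, hkC⟩ := (hC.and ((eventually_ge_atTop 1).and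
    (tendsto_natCast_atTop_atTop.eventually_gt_atTop C))).exists
  have hk0 : (0 : ℝ) < k := by exact_mod_cast hk1
  rw [Real.norm_of_nonneg (by positivity), Real.norm_of_nonneg (by positivity)] at hk
  exact absurd (le_of_mul_le_mul_right hk hk0) (not_le.2 hkC)

theorem CGpub_tribes_isTheta :
    (fun k : ℕ => (CGpub (tribes k k)).toReal) =Θ[atTop] fun k : ℕ => (k : ℝ) :=
  isTheta_of_le_of_le (Real.exp_pos 1).le
    (fun _ hk => (le_CGns_tribes hk).trans CGns_le_CGpub) fun _ hk => CGpub_tribes_le hk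

theorem CGns_tribes_isTheta :
    (fun k : ℕ => (CGns (tribes k k)).toReal) =Θ[atTop] fun k : ℕ => (k : ℝ) :=
  isTheta_of_le_of_le (Real.exp_pos 1).le
    (fun _ hk => le_CGns_tribes hk) fun _ hk => CGns_le_CGpub.trans (CGpub_tribes_le hk)

end Asymptotics

end CertificateGame

/-- Here `n = k^2`, so `√n` is `k` and `Θ(n)` reads `Θ(k^2)`. -/
theorem mainTheorem12 :
    (∀ k : ℕ, 1 ≤ k →
      CertificateGame.CGpub (CertificateGame.orFn k) =
        CertificateGame.CGns (CertificateGame.orFn k)) ∧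
    ((fun k : ℕ => (CertificateGame.CGpub (CertificateGame.orFn k)).toReal)
      =Θ[Filter.atTop] fun k : ℕ => (k : ℝ)) ∧
    ((fun k : ℕ => (CertificateGame.CGns (CertificateGame.orFn k)).toReal)
      =Θ[Filter.atTop] fun k : ℕ => (k : ℝ)) ∧
    ((fun k : ℕ => (CertificateGame.CGpub (CertificateGame.andFn k)).toReal)
      =Θ[Filter.atTop] fun k : ℕ => (k : ℝ)) ∧
    ((fun k : ℕ => (CertificateGame.CGns (CertificateGame.andFn k)).toReal)
      =Θ[Filter.atTop] fun k : ℕ => (k : ℝ)) ∧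
    ((fun k : ℕ => (CertificateGame.CGpub (CertificateGame.tribes k k)).toReal)
      =Θ[Filter.atTop] fun k : ℕ => (k : ℝ)) ∧
    ((fun k : ℕ => (CertificateGame.CGns (CertificateGame.tribes k k)).toReal)
      =Θ[Filter.atTop] fun k : ℕ => (k : ℝ)) ∧
    ((fun k : ℕ => (CertificateGame.CG (CertificateGame.tribes k k)).toReal)
      =Θ[Filter.atTop] fun k : ℕ => (k : ℝ) ^ 2) ∧
    ¬ ((fun k : ℕ => (CertificateGame.CGpub (CertificateGame.compose
          (CertificateGame.orFn k) (CertificateGame.andFn k))).toReal)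
      =Θ[Filter.atTop] fun k : ℕ =>
        (CertificateGame.CGpub (CertificateGame.orFn k)).toReal *
          (CertificateGame.CGpub (CertificateGame.andFn k)).toReal) ∧
    ¬ ((fun k : ℕ => (CertificateGame.CGns (CertificateGame.compose
          (CertificateGame.orFn k) (CertificateGame.andFn k))).toReal)
      =Θ[Filter.atTop] fun k : ℕ =>
        (CertificateGame.CGns (CertificateGame.orFn k)).toReal *
          (CertificateGame.CGns (CertificateGame.andFn k)).toReal) := by
  open CertificateGame in
  have hor := isTheta_of_eq_ofReal (fun k => Nat.cast_nonneg k) fun k hk => CGpub_orFn (k := k) hk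
  have hor' := isTheta_of_eq_ofReal (fun k => Nat.cast_nonneg k) fun k hk => CGns_orFn (k := k) hk
  have hand := isTheta_of_eq_ofReal (fun k => Nat.cast_nonneg k) fun k hk => CGpub_andFn (k := k) hk
  have hand' := isTheta_of_eq_ofReal (fun k => Nat.cast_nonneg k) fun k hk => CGns_andFn (k := k) hk
  exact ⟨fun k hk => (CGpub_orFn hk).trans (CGns_orFn hk).symm, hor, hor', hand, hand',
    CGpub_tribes_isTheta, CGns_tribes_isTheta,
    isTheta_of_eq_ofReal (fun k => by positivity) fun k hk => CG_tribes hk,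
    -- `tribes k k` unfolds to the composition in the goal.
    not_isTheta_mul CGpub_tribes_isTheta hor hand,
    not_isTheta_mul CGns_tribes_isTheta hor' hand'⟩
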